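/- Let $n$ and $m_1,\dots,m_n$ be positive integers, and let $X_1,\dots,X_n$ be independent random variables, $X_j$ being uniformly distributed on the $2m_j+1$ integers in $[-m_j,m_j]$. Let $\chi_j(p)=1/(2m_j+1)$ for integers $|p|\le m_j$ and $\chi_j(p)=0$ for integers $|p|>m_j$. Then for every integer $p$ the probability $P\left(\sum_{j=1}^n X_j=p\right)$ equals $$g_n(p):=\sum_{\substack{k_1,\dots,k_n\in\mathbf Z\\ k_1+\cdots+k_n=p}}\ \prod_{j=1}^n\chi_j(k_j),$$ and $$g_n(p)=\frac{M}{2^n}\sum_{\vec\varepsilon\in\{-1,1\}^n}\operatorname{sign}\Big(2p+\sum_{j=1}^n(2m_j+1)\varepsilon_j\Big)\Big(\prod_{j=1}^n\varepsilon_j\Big)\sum_{k=0}^{\lfloor (n-1)/2\rfloor}(-1)^k\,b_{2k}^{(n)}\,\frac{\Big(2p+\sum_{j=1}^n(2m_j+1)\varepsilon_j\Big)^{n-2k-1}}{(n-2k-1)!},$$ where $M=\prod_{j=1}^n(2m_j+1)^{-1}$, $\operatorname{sign}(y)$ is $1$, $0$ or $-1$ according as $y>0$, $y=0$ or $y<0$,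 and the rational numbers $b_{2k}^{(n)}$ are the coefficients in the Laurent series expansion at the origin $$\Big(\frac1{\sin x}\Big)^n=\sum_{k=0}^\infty b_{2k}^{(n)}\,x^{2k-n}\qquad(0<|x|<\pi).$$ Explicitly, for every integer $k\ge 0$ (with the convention $0^0=1$), $$b_{2k}^{(n)}=(-1)^k\binom{n+2k}{n}\sum_{m=0}^{2k}\frac{n}{n+m}\binom{2k}{m}\frac1{2^m(2k+m)!}\sum_{r=0}^m(-1)^r\binom mr(2r-m)^{2k+m}.$$ -/

import Mathlib

/-- The mass function of the uniform distribution on the `2 * m + 1` integers in `[-m, m]`. -/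
def uniformMass (m : ℕ) (p : ℤ) : ℚ :=
  if |p| ≤ (m : ℤ) then 1 / (2 * (m : ℚ) + 1) else 0

/-- The `n`-fold convolution of the uniform mass functions on `[-m j, m j]`: the sum of
`∏ j, uniformMass (m j) (k j)` over all integer vectors `k` with `k 1 + ⋯ + k n = p`
(only finitely many terms are nonzero). -/
noncomputable def convMass {n : ℕ} (m : Fin n → ℕ) (p : ℤ) : ℚ :=
  ∑ᶠ (k : Fin n → ℤ) (_ : ∑ j, k j = p), ∏ j, uniformMass (m j) (k j)

/-- The rational number `b_{2k}^{(n)}`: the coefficient of `x ^ (2 k - n)` in the Laurent series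
at `0` of `(1 / sin x) ^ n`, taken in the field of formal Laurent series over `ℚ`. -/
noncomputable def cscCoeff (n k : ℕ) : ℚ :=
  ((1 / (PowerSeries.sin ℚ : LaurentSeries ℚ)) ^ n).coeff (2 * (k : ℤ) - (n : ℤ))

/-- The integer `2 p + ∑ j, (2 m_j + 1) ε_j`. -/
def signedShift {n : ℕ} (m : Fin n → ℕ) (p : ℤ) (ε : Fin n → ℤ) : ℤ :=
  2 * p + ∑ j, (2 * (m j : ℤ) + 1) * ε j

/-- The set `{-1, 1}^n` of vectors of signs. -/
def signVectors (n : ℕ) : Finset (Fin n → ℤ) :=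
  Fintype.piFinset fun _ => {-1, 1}

/-! Put `w = sin X / X`, so that `b_{2k}^{(n)}` is the coefficient of `X^{2k}` in `w⁻ⁿ`. The inner
sum over `k` is, up to a power of `i`, the coefficient of `X^{n-1}` in `w⁻ⁿ e^{iyX}`. A recursion in
`n` shows that it equals the central factorial `(y+n-2)(y+n-4)⋯(y-n+2)/(n-1)!`
(`sum_cscCoeff_mul_pow`).

The signed sum over `ε` applies `∏ⱼ (T^{2mⱼ+1} - T^{-(2mⱼ+1)})`, `T` being the unit shift. Each
factor is `T - T⁻¹` times a geometric sum, so the result is a sum over the box of vectors `k` of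
`n`-th central differences of `sign(y)` times the central factorial. Such a difference is zero
unless `∑ kⱼ = p`, when it is a constant (`sum_sign_mul_centralFactorial`). This counts the lattice
points that define `convMass`.

For the explicit `b_{2k}^{(n)}`, `w⁻ⁿ` is replaced modulo a power of `X` by a polynomial in `w`, and
powers of `sin` are expanded in exponentials. The Laurent expansion holds because `sin z / z` has no
zero in `|z| < π`. -/

open PowerSeries in
/-- The formal power series `sin X / X`. -/
noncomputable def sincSeries (K : Type*) [Field K] [Algebra ℚ K] : PowerSeries K :=
  .mk fun i => coeff (i + 1) (sin K)

/-! ### The formal series of `sin X / X` and its inverse. -/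

section SincSeries

open PowerSeries

variable (K : Type*) [Field K] [Algebra ℚ K]

theorem X_mul_sincSeries : (X : K⟦X⟧) * sincSeries K = PowerSeries.sin K := by
  ext i
  cases i with
  | zero => simp [PowerSeries.sin]
  | succ i => rw [mul_comm, coeff_succ_mul_X, sincSeries, coeff_mk]

theorem constantCoeff_sincSeries : constantCoeff (sincSeries K) = 1 := by
  rw [← coeff_zero_eq_constantCoeff_apply, sincSeries, coeff_mk, PowerSeries.sin, coeff_mk]
  simp

theorem sincSeries_mul_inv : sincSeries K * (sincSeries K)⁻¹ = 1 :=
  PowerSeries.mul_inv_cancel _ (by rw [constantCoeff_sincSeries]; exact one_ne_zero)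

variable {K} in
theorem eq_inv_sincSeries {φ : K⟦X⟧} (h : sincSeries K * φ = 1) : φ = (sincSeries K)⁻¹ := by
  calc φ = sincSeries K * (sincSeries K)⁻¹ * φ := by rw [sincSeries_mul_inv, one_mul]
    _ = (sincSeries K)⁻¹ * (sincSeries K * φ) := by ring
    _ = _ := by rw [h, mul_one]

theorem evalNegHom_sincSeries : evalNegHom (sincSeries K) = sincSeries K := by
  ext i
  rw [evalNegHom, coeff_rescale, sincSeries, coeff_mk, PowerSeries.sin, coeff_mk]
  split_ifs with h
  · simp
  · have : Even i := by
      rw [Nat.even_add_one, not_not] at h; exact h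
    rw [this.neg_one_pow, one_mul]

theorem evalNegHom_inv_sincSeries : evalNegHom (sincSeries K)⁻¹ = (sincSeries K)⁻¹ := by
  apply eq_inv_sincSeries
  nth_rewrite 1 [← evalNegHom_sincSeries K]
  rw [← map_mul, sincSeries_mul_inv, map_one]

theorem coeff_inv_sincSeries_pow_of_odd (n : ℕ) {i : ℕ} (hi : Odd i) :
    coeff i ((sincSeries K)⁻¹ ^ n) = 0 := by
  have h : evalNegHom ((sincSeries K)⁻¹ ^ n) = (sincSeries K)⁻¹ ^ n := by
    rw [map_pow, evalNegHom_inv_sincSeries]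
  have h' := congrArg (coeff i) h
  rw [evalNegHom, coeff_rescale, hi.neg_one_pow, neg_one_mul] at h'
  have : CharZero K := algebraRat.charZero K
  exact self_eq_neg.mp h'.symm

theorem map_sincSeries {L : Type*} [Field L] [Algebra ℚ L] (f : K →+* L) :
    PowerSeries.map f (sincSeries K) = sincSeries L := by
  ext i
  rw [coeff_map, sincSeries, coeff_mk, ← coeff_map, map_sin, sincSeries, coeff_mk]

theorem map_inv_sincSeries {L : Type*} [Field L] [Algebra ℚ L] (f : K →+* L) :
    PowerSeries.map f (sincSeries K)⁻¹ = (sincSeries L)⁻¹ := by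
  apply eq_inv_sincSeries
  rw [← map_sincSeries K f, ← map_mul, sincSeries_mul_inv, map_one]

/-- Factoring `X^{-n}` out of `(1 / sin X)^n` moves the index from `2k - n` to `2k` and leaves an
ordinary power series. -/
theorem cscCoeff_eq_coeff (n k : ℕ) :
    cscCoeff n k = coeff (2 * k) ((sincSeries ℚ)⁻¹ ^ n) := by
  have hX : (HahnSeries.single 1 1 : LaurentSeries ℚ) ≠ 0 := by simp
  have h1 : (1 / (PowerSeries.sin ℚ : LaurentSeries ℚ)) =
      HahnSeries.single (-1) 1 * (((sincSeries ℚ)⁻¹ : ℚ⟦X⟧) : LaurentSeries ℚ) := by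
    symm
    rw [← X_mul_sincSeries, PowerSeries.coe_mul, PowerSeries.coe_X]
    have h2 : ((sincSeries ℚ : ℚ⟦X⟧) : LaurentSeries ℚ) *
        (((sincSeries ℚ)⁻¹ : ℚ⟦X⟧) : LaurentSeries ℚ) = 1 := by
      rw [← PowerSeries.coe_mul, sincSeries_mul_inv, PowerSeries.coe_one]
    have h3 : (HahnSeries.single (-1) 1 : LaurentSeries ℚ) * HahnSeries.single 1 1 = 1 := by
      simp
    have h4 : ((sincSeries ℚ : ℚ⟦X⟧) : LaurentSeries ℚ) ≠ 0 := left_ne_zero_of_mul_eq_one h2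
    rw [eq_div_iff (mul_ne_zero hX h4)]
    linear_combination (HahnSeries.single (-1) 1 * HahnSeries.single 1 1 : LaurentSeries ℚ) * h2 + h3
  have h5 : (2 * (k : ℤ) - n) = ((2 * k : ℕ) : ℤ) + n • (-1 : ℤ) := by
    simp; ring
  rw [cscCoeff, h1, mul_pow, HahnSeries.single_pow, one_pow, ← map_pow, h5,
    HahnSeries.coeff_single_mul_add, one_mul, LaurentSeries.coeff_coe_powerSeries]

theorem cast_cscCoeff (n k : ℕ) :
    (cscCoeff n k : ℂ) = coeff (2 * k) ((sincSeries ℂ)⁻¹ ^ n) := by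
  rw [cscCoeff_eq_coeff, ← map_inv_sincSeries ℚ (Rat.castHom ℂ), ← map_pow, coeff_map]
  simp

end SincSeries

/-! ### The inner sum as a central factorial. -/

section ExpSeries

open PowerSeries

/-- The formal power series `exp (i y X)`. -/
noncomputable def expI (y : ℂ) : ℂ⟦X⟧ := rescale (Complex.I * y) (exp ℂ)

theorem coeff_expI (y : ℂ) (k : ℕ) :
    coeff k (expI y) = Complex.I ^ k * (y ^ k / (k.factorial : ℂ)) := by
  rw [expI, coeff_rescale, coeff_exp]
  simp; ring

theorem expI_mul (y z : ℂ) : expI y * expI z = expI (y + z) := by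
  rw [expI, expI, exp_mul_exp_eq_exp_add, expI, mul_add]

theorem derivative_expI (y : ℂ) : d⁄dX ℂ (expI y) = C (Complex.I * y) * expI y := by
  ext k
  rw [coeff_derivative, coeff_C_mul, coeff_expI, coeff_expI, Nat.factorial_succ]
  have h1 : (k.factorial : ℂ) ≠ 0 := by exact_mod_cast k.factorial_ne_zero
  have h2 : (k + 1 : ℂ) ≠ 0 := by exact_mod_cast k.succ_ne_zero
  push_cast
  field_simp
  ring

theorem expI_one : expI 1 = PowerSeries.cos ℂ + C Complex.I * PowerSeries.sin ℂ := by
  ext k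
  rw [coeff_expI, map_add, coeff_C_mul, PowerSeries.cos, PowerSeries.sin, coeff_mk, coeff_mk]
  obtain ⟨j, rfl | rfl⟩ := k.even_or_odd'
  · simp [pow_mul]; ring
  · have : ¬ Even (2 * j + 1) := by simp
    have h2 : (2 * j + 1) / 2 = j := by omega
    simp [this, h2, pow_succ, pow_mul]; ring

theorem derivative_sin : d⁄dX ℂ (PowerSeries.sin ℂ) = PowerSeries.cos ℂ := by
  ext k
  have h1 : (k.factorial : ℂ) ≠ 0 := by exact_mod_cast k.factorial_ne_zero
  have h2 : (k + 1 : ℂ) ≠ 0 := by exact_mod_cast k.succ_ne_zero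
  rw [coeff_derivative, PowerSeries.cos, PowerSeries.sin, coeff_mk, coeff_mk, Nat.factorial_succ]
  obtain ⟨j, rfl | rfl⟩ := k.even_or_odd'
  · have h3 : (2 * j + 1) / 2 = j := by omega
    have : ¬ Even (2 * j + 1) := by simp
    simp only [this, h3, if_false, even_two_mul, if_true]
    simp at h1 h2 ⊢
    field_simp
  · have h3 : Even (2 * j + 1 + 1) := by simp [Nat.even_add_one]
    simp [h3]

theorem sincSeries_add_X_mul_derivative :
    sincSeries ℂ + X * d⁄dX ℂ (sincSeries ℂ) = PowerSeries.cos ℂ := by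
  rw [← derivative_sin, ← X_mul_sincSeries, Derivation.leibniz]
  simp [add_comm]

/-- Expanding `e^{iX} = cos X + i sin X = w + X w' + i X w` produces a term in `w'`. The derivative
of `w^{-(n+1)} e^{iyX}` contains the same term, so comparing coefficients of `X^n` eliminates it. -/
theorem succ_mul_coeff_inv_sincSeries_pow_mul_expI (n : ℕ) (y : ℂ) :
    (n + 1 : ℂ) * coeff (n + 1) ((sincSeries ℂ)⁻¹ ^ (n + 2) * expI (y + 1)) =
      Complex.I * (y + n + 1) * coeff n ((sincSeries ℂ)⁻¹ ^ (n + 1) * expI y) := by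
  set w := sincSeries ℂ with hw
  set v := (sincSeries ℂ)⁻¹ with hv
  have hwv : w * v = 1 := sincSeries_mul_inv ℂ
  set D := d⁄dX ℂ w
  have hcos : PowerSeries.cos ℂ = w + X * D := sincSeries_add_X_mul_derivative.symm
  have hsin : PowerSeries.sin ℂ = X * w := (X_mul_sincSeries ℂ).symm
  have hder : d⁄dX ℂ (v ^ (n + 1) * expI y) =
      C (Complex.I * y) * (v ^ (n + 1) * expI y) - C (n + 1 : ℂ) * (v ^ (n + 2) * D * expI y) := by
    rw [Derivation.leibniz, derivative_expI, derivative_pow, derivative_inv']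
    simp only [smul_eq_mul, Nat.add_sub_cancel, map_add, map_one, map_natCast]
    push_cast
    ring
  have hmain : v ^ (n + 2) * expI (y + 1) = v ^ (n + 1) * expI y +
      X * (v ^ (n + 2) * D * expI y) + X * (C Complex.I * (v ^ (n + 1) * expI y)) := by
    rw [← expI_mul, expI_one, hcos, hsin]
    linear_combination (v ^ (n + 1) * expI y + X * C Complex.I * v ^ (n + 1) * expI y) * hwv
  have h1 := congrArg (coeff n) hder
  rw [coeff_derivative, map_sub, coeff_C_mul, coeff_C_mul] at h1
  rw [hmain, map_add, map_add, coeff_succ_X_mul, coeff_succ_X_mul, coeff_C_mul]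
  linear_combination h1

theorem coeff_inv_sincSeries_pow_mul_expI (n : ℕ) (y : ℂ) :
    coeff n ((sincSeries ℂ)⁻¹ ^ (n + 1) * expI y) =
      Complex.I ^ n * ((∏ i ∈ Finset.range n, (y + n - 1 - 2 * i)) / (n.factorial : ℂ)) := by
  induction n generalizing y with
  | zero =>
    simp [constantCoeff_sincSeries]
    rw [← coeff_zero_eq_constantCoeff_apply, coeff_expI]
    simp
  | succ n ih =>
    -- Starting from `y - 1`, the recursion contributes the factor `y + n`, which is the `i = 0`
    -- factor of the longer product.
    have h := succ_mul_coeff_inv_sincSeries_pow_mul_expI n (y - 1)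
    rw [ih, sub_add_cancel] at h
    have h1 : (n.factorial : ℂ) ≠ 0 := by exact_mod_cast n.factorial_ne_zero
    have h2 : (n + 1 : ℂ) ≠ 0 := by exact_mod_cast n.succ_ne_zero
    rw [← mul_right_inj' h2, h, Finset.prod_range_succ', Nat.factorial_succ]
    have h3 : ∏ i ∈ Finset.range n, (y - 1 + n - 1 - 2 * i) =
        ∏ i ∈ Finset.range n, (y + ((n + 1 : ℕ) : ℂ) - 1 - 2 * ((i + 1 : ℕ) : ℂ)) :=
      Finset.prod_congr rfl fun i _ => by push_cast; ring
    rw [h3]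
    push_cast
    field_simp
    ring

theorem sum_range_succ_eq_sum_even {M : Type*} [AddCommMonoid M] (n : ℕ) (f : ℕ → M)
    (hf : ∀ i, Odd i → f i = 0) :
    ∑ i ∈ Finset.range (n + 1), f i = ∑ k ∈ Finset.range (n / 2 + 1), f (2 * k) := by
  symm
  apply Finset.sum_of_injOn (fun k => 2 * k)
  · intro a _ b _ h; simpa using h
  · intro k hk; simp at hk ⊢; omega
  · intro i hi hi'
    apply hf
    rw [← Nat.not_even_iff_odd]
    rintro ⟨j, rfl⟩
    apply hi'
    simp at hi ⊢
    exact ⟨j, by omega, by omega⟩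
  · intros; rfl

theorem sum_cscCoeff_mul_pow (n : ℕ) (y : ℚ) :
    ∑ k ∈ Finset.range (n / 2 + 1), (-1) ^ k * cscCoeff (n + 1) k *
      (y ^ (n - 2 * k) / ((n - 2 * k).factorial : ℚ)) =
      (∏ i ∈ Finset.range n, (y + n - 1 - 2 * i)) / (n.factorial : ℚ) := by
  have h := coeff_inv_sincSeries_pow_mul_expI n y
  rw [coeff_mul, Finset.Nat.sum_antidiagonal_eq_sum_range_succ
    (fun i j => coeff i ((sincSeries ℂ)⁻¹ ^ (n + 1)) * coeff j (expI y)),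
    sum_range_succ_eq_sum_even] at h
  · have h1 : ∀ k ∈ Finset.range (n / 2 + 1),
        coeff (2 * k) ((sincSeries ℂ)⁻¹ ^ (n + 1)) * coeff (n - 2 * k) (expI y) =
        Complex.I ^ n * ((-1) ^ k * cscCoeff (n + 1) k *
          (y ^ (n - 2 * k) / ((n - 2 * k).factorial : ℂ))) := by
      intro k hk
      have hk' : 2 * k ≤ n := by simp at hk; omega
      have h2 : Complex.I ^ n = (-1) ^ k * Complex.I ^ (n - 2 * k) := by
        rw [← Complex.I_sq, ← pow_mul, ← pow_add]
        congr 1; omega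
      rw [← cast_cscCoeff, coeff_expI, h2]
      have h3 : ((-1 : ℂ) ^ k) * (-1) ^ k = 1 := by rw [← mul_pow]; simp
      linear_combination (-(cscCoeff (n + 1) k : ℂ) * (Complex.I ^ (n - 2 * k) *
        (y ^ (n - 2 * k) / ((n - 2 * k).factorial : ℂ)))) * h3
    rw [Finset.sum_congr rfl h1, ← Finset.mul_sum,
      mul_right_inj' (pow_ne_zero _ Complex.I_ne_zero)] at h
    exact_mod_cast h
  · intro i hi
    rw [coeff_inv_sincSeries_pow_of_odd ℂ _ hi, zero_mul]

end ExpSeries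

/-! ### Signed sums as central differences. -/

section CentralDifference

open LaurentPolynomial in
-- The right side telescopes.
theorem T_sub_T_eq_sum_mul (m : ℕ) :
    (T (2 * (m : ℤ) + 1) - T (-(2 * (m : ℤ) + 1)) : LaurentPolynomial ℚ) =
      (∑ k ∈ Finset.Icc (-(m : ℤ)) m, T (-2 * k)) * (T 1 - T (-1)) := by
  induction m with
  | zero => simp
  | succ m ih =>
    have hs : Finset.Icc (-((m + 1 : ℕ) : ℤ)) ((m + 1 : ℕ) : ℤ) =
        insert (-((m : ℤ) + 1)) (insert ((m : ℤ) + 1) (Finset.Icc (-(m : ℤ)) m)) := by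
      ext k; simp only [Finset.mem_insert, Finset.mem_Icc]; push_cast; omega
    rw [hs, Finset.sum_insert (by simp; omega), Finset.sum_insert (by simp), add_mul, add_mul, ← ih]
    simp only [mul_sub, ← T_add]
    push_cast
    ring_nf

open LaurentPolynomial in
/-- The signed sum over `{-1, 1}^n` of a product of step differences is a sum of `n`-th central
differences. -/
theorem sum_signVectors_T {n : ℕ} (m : Fin n → ℕ) :
    ∑ ε ∈ signVectors n, (C (∏ j, (ε j : ℚ)) * T (∑ j, (2 * (m j : ℤ) + 1) * ε j) :
        LaurentPolynomial ℚ) =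
      ∑ k ∈ Fintype.piFinset fun j => Finset.Icc (-(m j : ℤ)) (m j),
        ∑ r ∈ Finset.range (n + 1), C ((-1) ^ r * (n.choose r : ℚ)) *
          T (-2 * ∑ j, k j + (n - 2 * r)) := by
  have h1 : ∀ j, (T (2 * (m j : ℤ) + 1) - T (-(2 * (m j : ℤ) + 1)) : LaurentPolynomial ℚ) =
      ∑ e ∈ ({-1, 1} : Finset ℤ), C (e : ℚ) * T ((2 * (m j : ℤ) + 1) * e) := by
    intro j
    rw [Finset.sum_pair (by norm_num)]
    simp
    ring
  have hT : ∀ (ι : Type) (s : Finset ι) (f : ι → ℤ),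
      (∏ j ∈ s, T (f j) : LaurentPolynomial ℚ) = T (∑ j ∈ s, f j) := by
    classical
    intro ι s f
    induction s using Finset.induction_on with
    | empty => simp
    | insert a s ha ih => rw [Finset.prod_insert ha, Finset.sum_insert ha, ih, T_add]
  have h2 : (T 1 - T (-1) : LaurentPolynomial ℚ) ^ n = ∑ r ∈ Finset.range (n + 1),
      C ((-1) ^ r * (n.choose r : ℚ)) * T (n - 2 * r) := by
    rw [sub_eq_neg_add, add_pow]
    refine Finset.sum_congr rfl fun r hr => ?_
    have hr' : r ≤ n := by simp at hr; omega
    rw [neg_pow, T_pow, T_pow, map_mul, map_pow, map_neg, map_one, map_natCast, mul_assoc,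
      mul_assoc, mul_assoc, ← mul_assoc (T _), ← T_add, mul_comm (T _)]
    congr 3
    push_cast [hr']
    ring
  have h3 := Finset.prod_congr rfl fun j (_ : j ∈ Finset.univ) =>
    (h1 j).symm.trans (T_sub_T_eq_sum_mul (m j))
  rw [Finset.prod_univ_sum, Finset.prod_mul_distrib, Finset.prod_univ_sum, Finset.prod_const,
    Finset.card_univ, Fintype.card_fin, h2, Finset.sum_mul] at h3
  simp only [Finset.prod_mul_distrib, hT, ← map_prod] at h3
  rw [signVectors, h3]
  refine Finset.sum_congr rfl fun k _ => ?_
  rw [Finset.mul_sum]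
  refine Finset.sum_congr rfl fun r _ => ?_
  rw [Finset.mul_sum, T_add]
  ring

theorem sum_signVectors_mul {n : ℕ} (m : Fin n → ℕ) (F : ℤ → ℚ) (y : ℤ) :
    ∑ ε ∈ signVectors n, (∏ j, (ε j : ℚ)) * F (y + ∑ j, (2 * (m j : ℤ) + 1) * ε j) =
      ∑ k ∈ Fintype.piFinset fun j => Finset.Icc (-(m j : ℤ)) (m j),
        ∑ r ∈ Finset.range (n + 1), (-1) ^ r * (n.choose r : ℚ) *
          F (y + (-2 * ∑ j, k j + (n - 2 * r))) := by
  -- The functional sending `T a` to `F (y + a)` turns the Laurent polynomial identity into one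
  -- about values of `F`.
  let L : LaurentPolynomial ℚ →ₗ[ℚ] ℚ :=
    (Finsupp.linearCombination ℚ fun a => F (y + a)) ∘ₗ
      (AddMonoidAlgebra.coeffLinearEquiv ℚ).toLinearMap
  have hL : ∀ (c : ℚ) (a : ℤ), L (LaurentPolynomial.C c * LaurentPolynomial.T a) =
      c * F (y + a) := by
    intro c a
    rw [← LaurentPolynomial.single_eq_C_mul_T]
    simp [L, -LaurentPolynomial.single_eq_C_mul_T]
  have h := congrArg L (sum_signVectors_T m)
  simpa only [map_sum, hL] using h

/-- The central factorial `(y + n - 1) (y + n - 3) ⋯ (y - n + 1)`. -/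
def centralFactorial (n : ℕ) (y : ℚ) : ℚ :=
  ∏ i ∈ Finset.range n, (y + n - 1 - 2 * i)

/-- The factor with index `i = s + n` vanishes. -/
theorem centralFactorial_eq_zero {n : ℕ} {s : ℤ} (h1 : -(n : ℤ) ≤ s) (h2 : s < 0) :
    centralFactorial n ((2 * s + (n + 1) : ℤ) : ℚ) = 0 := by
  apply Finset.prod_eq_zero (i := (s + n).toNat) (by simp; omega)
  have h : (((s + n).toNat : ℤ) : ℚ) = ((s + n : ℤ) : ℚ) := by rw [Int.toNat_of_nonneg (by omega)]
  rw [Int.cast_natCast] at h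
  rw [h]
  push_cast
  ring

theorem centralFactorial_neg (n : ℕ) :
    centralFactorial n (-((n : ℚ) + 1)) = (-2) ^ n * (n.factorial : ℚ) := by
  rw [centralFactorial, ← Finset.prod_range_add_one_eq_factorial, Nat.cast_prod]
  calc _ = ∏ i ∈ Finset.range n, ((-2 : ℚ) * ((i + 1 : ℕ) : ℚ)) :=
        Finset.prod_congr rfl fun i _ => by push_cast; ring
    _ = _ := by rw [Finset.prod_mul_distrib]; simp

/-- An `(n+1)`-st difference kills a polynomial of degree at most `n`. -/
theorem sum_neg_one_pow_mul_centralFactorial (n : ℕ) (c : ℚ) :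
    ∑ r ∈ Finset.range (n + 2), (-1) ^ r * ((n + 1).choose r : ℚ) *
      centralFactorial n (c - 2 * r) = 0 := by
  let P : Polynomial ℚ := ∏ i ∈ Finset.range n,
    (Polynomial.C (-2) * Polynomial.X + Polynomial.C (c + n - 1 - 2 * i))
  have hP : P.natDegree < n + 1 := by
    refine Nat.lt_succ_of_le ((Polynomial.natDegree_prod_le _ _).trans ?_)
    calc _ ≤ ∑ i ∈ Finset.range n, 1 :=
          Finset.sum_le_sum fun i _ => Polynomial.natDegree_linear_le
      _ = n := by simp
  have heval : ∀ x, P.eval x = centralFactorial n (c - 2 * x) := by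
    intro x
    rw [Polynomial.eval_prod, centralFactorial]
    refine Finset.prod_congr rfl fun i _ => ?_
    simp
    ring
  have h := congrFun (Polynomial.fwdDiff_iter_eq_zero_of_degree_lt hP) 0
  rw [fwdDiff_iter_eq_sum_shift] at h
  have h' : ∑ r ∈ Finset.range (n + 2), (-1) ^ r * ((n + 1).choose r : ℚ) *
      centralFactorial n (c - 2 * r) = (-1) ^ (n + 1) * (0 : ℚ → ℚ) 0 := by
    rw [← h, Finset.mul_sum]
    refine Finset.sum_congr rfl fun r hr => ?_
    have hr' : r ≤ n + 1 := by simp at hr; omega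
    have h2 : (-1 : ℚ) ^ (n + 1) * (-1) ^ (n + 1 - r) = (-1) ^ r := by
      rw [← pow_add, show n + 1 + (n + 1 - r) = 2 * (n + 1 - r) + r by omega, pow_add, pow_mul]
      simp
    rw [heval, ← h2]
    simp
    ring
  rw [h']
  simp

/-- The sample points are `y = 2(q-r) + n + 1`, and the central factorial vanishes at those with
`|y| ≤ n - 1`. For `q < 0` no sample exceeds `n - 1`, so the sign may be taken to be `-1`
throughout; for `q > 0` none is below `-(n-1)`, so it may be `+1`. Both sums are then zero. For `q =
0` only the last sample, `y = -(n+1)`, disagrees with the constant sign `+1`, and the sum is minus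
twice its unsigned term. -/
theorem sum_sign_mul_centralFactorial (n : ℕ) (q : ℤ) :
    ∑ r ∈ Finset.range (n + 2), (-1) ^ r * ((n + 1).choose r : ℚ) *
      (((2 * q + ((n + 1 : ℕ) - 2 * r) : ℤ).sign : ℚ) *
        centralFactorial n ((2 * q + ((n + 1 : ℕ) - 2 * r) : ℤ) : ℚ)) =
      if q = 0 then 2 ^ (n + 1) * (n.factorial : ℚ) else 0 := by
  have hz := sum_neg_one_pow_mul_centralFactorial n ((2 * q + (n + 1) : ℤ) : ℚ)
  have hy : ∀ r : ℕ, (2 * q + ((n + 1 : ℕ) - 2 * r) : ℤ) = 2 * (q - r) + (n + 1) := by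
    intro r; push_cast; ring
  have hc : ∀ r : ℕ, ((2 * q + (n + 1) : ℤ) : ℚ) - 2 * r = ((2 * (q - r) + (n + 1) : ℤ) : ℚ) := by
    intro r; push_cast; ring
  simp only [hc] at hz
  simp only [hy]
  rcases lt_trichotomy q 0 with hq | rfl | hq
  · rw [if_neg hq.ne, ← neg_zero, ← hz, ← Finset.sum_neg_distrib]
    refine Finset.sum_congr rfl fun r _ => ?_
    rcases lt_or_ge (2 * (q - r) + (n + 1)) 0 with h | h
    · rw [Int.sign_eq_neg_one_of_neg h]; push_cast; ring
    · rw [centralFactorial_eq_zero (by omega) (by omega)]; simp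
  · rw [if_pos rfl]
    rw [Finset.sum_range_succ] at hz ⊢
    have hs : ∑ r ∈ Finset.range (n + 1), (-1) ^ r * ((n + 1).choose r : ℚ) *
        (((2 * (0 - (r : ℤ)) + (n + 1)).sign : ℚ) *
          centralFactorial n ((2 * (0 - (r : ℤ)) + (n + 1) : ℤ) : ℚ)) =
        ∑ r ∈ Finset.range (n + 1), (-1) ^ r * ((n + 1).choose r : ℚ) *
          centralFactorial n ((2 * (0 - (r : ℤ)) + (n + 1) : ℤ) : ℚ) := by
      refine Finset.sum_congr rfl fun r hr => ?_
      have hr' : r < n + 1 := by simpa using hr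
      rcases lt_or_ge 0 (2 * (0 - (r : ℤ)) + (n + 1)) with h | h
      · rw [Int.sign_eq_one_of_pos h]; simp
      · rw [centralFactorial_eq_zero (by omega) (by omega)]; simp
    have hend : (2 * (0 - ((n + 1 : ℕ) : ℤ)) + (n + 1)) = -((n : ℤ) + 1) := by push_cast; ring
    have hend' : centralFactorial n ((-((n : ℤ) + 1) : ℤ) : ℚ) = (-2) ^ n * (n.factorial : ℚ) := by
      rw [← centralFactorial_neg]; push_cast; rfl
    rw [hend, hend'] at hz
    rw [hs, hend, hend', Int.sign_eq_neg_one_of_neg (by omega)]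
    have h2 : (-1 : ℚ) ^ (n + 1) * (-2) ^ n = -2 ^ n := by
      rw [pow_succ, mul_right_comm, ← mul_pow]; norm_num
    rw [Nat.choose_self] at hz ⊢
    push_cast at hz ⊢
    linear_combination hz - 2 * (n.factorial : ℚ) * h2
  · rw [if_neg hq.ne', ← hz]
    refine Finset.sum_congr rfl fun r hr => ?_
    have hr' : r < n + 2 := by simpa using hr
    rcases lt_or_ge 0 (2 * (q - r) + (n + 1)) with h | h
    · rw [Int.sign_eq_one_of_pos h]; simp
    · rw [centralFactorial_eq_zero (by omega) (by omega)]; simp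

end CentralDifference

/-! ### The formula for the convolution. -/

section ConvMass

theorem convMass_eq_sum {n : ℕ} (m : Fin n → ℕ) (p : ℤ) :
    convMass m p = ∑ k ∈ Fintype.piFinset fun j => Finset.Icc (-(m j : ℤ)) (m j),
      if ∑ j, k j = p then ∏ j, uniformMass (m j) (k j) else 0 := by
  rw [convMass]
  simp only [finsum_eq_if]
  apply finsum_eq_sum_of_support_subset
  intro k hk
  rw [Function.mem_support, ite_ne_right_iff, Finset.prod_ne_zero_iff] at hk
  simp only [Finset.mem_coe, Fintype.mem_piFinset, Finset.mem_Icc]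
  intro j
  by_contra h
  apply hk.2 j (Finset.mem_univ j)
  rw [uniformMass, if_neg]
  rwa [abs_le]

theorem prod_uniformMass {n : ℕ} (m : Fin n → ℕ) {k : Fin n → ℤ}
    (hk : k ∈ Fintype.piFinset fun j => Finset.Icc (-(m j : ℤ)) (m j)) :
    ∏ j, uniformMass (m j) (k j) = ∏ j, (2 * (m j : ℚ) + 1)⁻¹ := by
  refine Finset.prod_congr rfl fun j _ => ?_
  rw [Fintype.mem_piFinset] at hk
  rw [uniformMass, if_pos (abs_le.mpr (Finset.mem_Icc.mp (hk j))), one_div]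

theorem convMass_eq_sum_signVectors {n : ℕ} (hn : 0 < n) (m : Fin n → ℕ) (p : ℤ) :
    convMass m p = (∏ j, (2 * (m j : ℚ) + 1)⁻¹) / 2 ^ n *
      ∑ ε ∈ signVectors n,
        ((signedShift m p ε).sign : ℚ) * (∏ j, (ε j : ℚ)) *
          ∑ k ∈ Finset.range ((n - 1) / 2 + 1),
            (-1) ^ k * cscCoeff n k *
              ((signedShift m p ε : ℚ) ^ (n - 2 * k - 1) /
                (Nat.factorial (n - 2 * k - 1) : ℚ)) := by
  obtain ⟨N, rfl⟩ : ∃ N, n = N + 1 := ⟨n - 1, by omega⟩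
  have hf : (N.factorial : ℚ) ≠ 0 := by exact_mod_cast N.factorial_ne_zero
  have hinner : ∀ y : ℚ, ∑ k ∈ Finset.range ((N + 1 - 1) / 2 + 1),
      (-1) ^ k * cscCoeff (N + 1) k *
        (y ^ (N + 1 - 2 * k - 1) / (Nat.factorial (N + 1 - 2 * k - 1) : ℚ)) =
      centralFactorial N y / N.factorial := by
    intro y
    rw [centralFactorial, ← sum_cscCoeff_mul_pow]
    refine Finset.sum_congr rfl fun k _ => ?_
    rw [show N + 1 - 2 * k - 1 = N - 2 * k by omega]
  have hmain := sum_signVectors_mul m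
    (fun y => (y.sign : ℚ) * centralFactorial N (y : ℚ)) (2 * p)
  have hrhs : ∀ k : Fin (N + 1) → ℤ, ∑ r ∈ Finset.range (N + 1 + 1),
      (-1) ^ r * ((N + 1).choose r : ℚ) *
        (((2 * p + (-2 * ∑ j, k j + ((N + 1 : ℕ) - 2 * r)) : ℤ).sign : ℚ) *
          centralFactorial N ((2 * p + (-2 * ∑ j, k j + ((N + 1 : ℕ) - 2 * r)) : ℤ) : ℚ)) =
      if ∑ j, k j = p then 2 ^ (N + 1) * (N.factorial : ℚ) else 0 := by
    intro k
    have h := sum_sign_mul_centralFactorial N (p - ∑ j, k j)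
    have hp : (p - ∑ j, k j = 0) ↔ ∑ j, k j = p := by rw [sub_eq_zero, eq_comm]
    simp only [hp] at h
    rw [← h]
    refine Finset.sum_congr rfl fun r _ => ?_
    rw [show 2 * p + (-2 * ∑ j, k j + (((N + 1 : ℕ) : ℤ) - 2 * r)) =
      2 * (p - ∑ j, k j) + (((N + 1 : ℕ) : ℤ) - 2 * r) by ring]
  have hlhs : ∑ ε ∈ signVectors (N + 1), ((signedShift m p ε).sign : ℚ) * (∏ j, (ε j : ℚ)) *
      (centralFactorial N (signedShift m p ε : ℚ) / N.factorial) =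
      (∑ k ∈ Fintype.piFinset fun j => Finset.Icc (-(m j : ℤ)) (m j),
        if ∑ j, k j = p then 2 ^ (N + 1) * (N.factorial : ℚ) else 0) / N.factorial := by
    -- The difference at box point `k` is centred at `2(p - ∑ kⱼ)`, so it detects exactly `∑ kⱼ =
    -- p`.
    rw [← Finset.sum_congr rfl fun k _ => hrhs k, ← hmain, Finset.sum_div]
    refine Finset.sum_congr rfl fun ε _ => ?_
    simp only [signedShift]
    ring
  simp only [hinner]
  rw [hlhs, convMass_eq_sum, Finset.sum_div, Finset.mul_sum]
  refine Finset.sum_congr rfl fun k hk => ?_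
  split_ifs
  · rw [prod_uniformMass m hk]
    field_simp
  · simp

end ConvMass

/-! ### The closed form of the Laurent coefficients. -/

section ExplicitCoefficients

open PowerSeries

theorem fwdDiff_iter_inv (N : ℕ) {y : ℚ} (hy : 0 < y) :
    (fwdDiff 1)^[N] (fun x : ℚ => x⁻¹) y =
      (-1) ^ N * (N.factorial : ℚ) / ∏ i ∈ Finset.range (N + 1), (y + i) := by
  induction N generalizing y with
  | zero => simp
  | succ N ih =>
    rw [Function.iterate_succ_apply', fwdDiff, ih hy, ih (by linarith), Finset.prod_range_succ,
      Finset.prod_range_succ' _ (N + 1), Finset.prod_range_succ' _ N]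
    have h1 : ∏ i ∈ Finset.range N, (y + 1 + i) = ∏ i ∈ Finset.range N, (y + ((i + 1 : ℕ) : ℚ)) :=
      Finset.prod_congr rfl fun i _ => by push_cast; ring
    have h2 : ∏ i ∈ Finset.range N, (y + ((i + 1 : ℕ) : ℚ)) ≠ 0 :=
      (Finset.prod_pos fun i _ => by positivity).ne'
    have h3 : y + (N + 1) ≠ 0 := by positivity
    have h4 : y + 1 + N ≠ 0 := by positivity
    rw [h1, Finset.prod_range_succ _ N, Nat.factorial_succ]
    push_cast at h2 ⊢
    field_simp
    ring

/-- This is the Beta integral of `t^{n-1}(1-t)^N` over `[0,1]`, normalized to 1. Algebraically it is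
the `N`-th difference of `1/x` at `n`. -/
theorem sum_neg_one_pow_mul_choose_div {n : ℕ} (hn : 0 < n) (N : ℕ) :
    ∑ l ∈ Finset.range (N + 1), (-1) ^ l * ((n : ℚ) / (n + l)) * (N.choose l : ℚ) *
      ((n + N).choose n : ℚ) = 1 := by
  have hn' : (0 : ℚ) < n := by exact_mod_cast hn
  have h := fwdDiff_iter_inv N hn'
  rw [fwdDiff_iter_eq_sum_shift] at h
  have hprod : (∏ i ∈ Finset.range (N + 1), ((n : ℚ) + i)) * ((n - 1).factorial : ℚ) =
      ((n + N).factorial : ℚ) := by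
    obtain ⟨a, rfl⟩ : ∃ a, n = a + 1 := ⟨n - 1, by omega⟩
    have := Nat.factorial_mul_ascFactorial a (N + 1)
    rw [Nat.ascFactorial_eq_prod_range] at this
    rw [show a + 1 + N = a + (N + 1) by ring, ← this]
    push_cast
    simp [mul_comm]
  have hchoose : ((n + N).choose n : ℚ) * n.factorial * N.factorial = (n + N).factorial := by
    have := Nat.choose_mul_factorial_mul_factorial (Nat.le_add_right n N)
    rw [Nat.add_sub_cancel_left] at this
    exact_mod_cast this
  have hfac : (n.factorial : ℚ) = n * (n - 1).factorial := by
    exact_mod_cast (Nat.mul_factorial_pred hn.ne').symm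
  have hP : ∏ i ∈ Finset.range (N + 1), ((n : ℚ) + i) ≠ 0 :=
    (Finset.prod_pos fun i _ => by positivity).ne'
  have hF : ((n - 1).factorial : ℚ) ≠ 0 := by exact_mod_cast (n - 1).factorial_ne_zero
  have hsum : ∑ l ∈ Finset.range (N + 1), (-1) ^ l * ((n : ℚ) / (n + l)) * (N.choose l : ℚ) *
      ((n + N).choose n : ℚ) = (-1) ^ N * n * ((n + N).choose n : ℚ) *
        ((-1) ^ N * (N.factorial : ℚ) / ∏ i ∈ Finset.range (N + 1), ((n : ℚ) + i)) := by
    rw [← h, Finset.mul_sum]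
    refine Finset.sum_congr rfl fun l hl => ?_
    have hl' : l ≤ N := by simp at hl; omega
    have h2 : (-1 : ℚ) ^ N * (-1) ^ (N - l) = (-1) ^ l := by
      rw [← pow_add, show N + (N - l) = 2 * (N - l) + l by omega, pow_add, pow_mul]
      simp
    rw [← h2]
    simp [div_eq_mul_inv]
    ring
  have hsq : (-1 : ℚ) ^ N * (-1) ^ N = 1 := by rw [← mul_pow]; simp
  rw [hsum]
  field_simp
  rw [hfac, ← hprod] at hchoose
  apply mul_right_cancel₀ hF
  linear_combination hchoose + n * ((n + N).choose n : ℚ) * (N.factorial : ℚ) *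
    ((n - 1).factorial : ℚ) * hsq

theorem X_pow_dvd_of_derivative {φ : ℚ⟦X⟧} {N : ℕ} (h0 : constantCoeff φ = 0)
    (h : X ^ N ∣ d⁄dX ℚ φ) : X ^ (N + 1) ∣ φ := by
  rw [X_pow_dvd_iff] at h ⊢
  intro i hi
  cases i with
  | zero => simpa using h0
  | succ i =>
    have := h i (by omega)
    rw [coeff_derivative] at this
    exact (mul_eq_zero.mp this).resolve_right (by positivity)

/-- Modulo `X ^ (N + 1)`, the inverse `n`-th power of `sin X / X` is a combination of its first
`N` powers. -/
theorem coeff_inv_sincSeries_pow {n : ℕ} (hn : 0 < n) (N : ℕ) :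
    coeff N ((sincSeries ℚ)⁻¹ ^ n) = ∑ l ∈ Finset.range (N + 1),
      (-1) ^ l * ((n : ℚ) / (n + l)) * (N.choose l : ℚ) * ((n + N).choose n : ℚ) *
        coeff N (sincSeries ℚ ^ l) := by
  set w := sincSeries ℚ
  have hw1 : constantCoeff w = 1 := constantCoeff_sincSeries ℚ
  have hwv : w * w⁻¹ = 1 := sincSeries_mul_inv ℚ
  set a : ℕ → ℚ := fun l => (-1) ^ l * ((n : ℚ) / (n + l)) * (N.choose l : ℚ) *
    ((n + N).choose n : ℚ)
  -- The `a l` are the coefficients of the polynomial `A(t) = ∑ a l t^{n+l}` with `A' =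
  -- n·choose(n+N, n)·t^{n-1}(1-t)^N` and `A(1) = 1`.
  have hder : d⁄dX ℚ (∑ l ∈ Finset.range (N + 1), C (a l) * w ^ (n + l)) =
      C (n * ((n + N).choose n : ℚ)) * (w ^ (n - 1) * (1 - w) ^ N * d⁄dX ℚ w) := by
    rw [map_sum, sub_eq_neg_add, add_pow, Finset.mul_sum, Finset.sum_mul, Finset.mul_sum]
    refine Finset.sum_congr rfl fun l _ => ?_
    have hnl : (n : ℚ) + l ≠ 0 := by positivity
    have ha : a l * (n + l) = n * ((n + N).choose n : ℚ) * ((-1) ^ l * (N.choose l : ℚ)) := by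
      simp only [a]; field_simp
    rw [Derivation.leibniz, derivative_C, derivative_pow, smul_zero, add_zero, smul_eq_mul,
      show n + l - 1 = (n - 1) + l by omega, pow_add, neg_pow]
    have hC := congrArg (C : ℚ → ℚ⟦X⟧) ha
    simp only [map_mul, map_add, map_natCast, map_pow, map_neg, map_one] at hC ⊢
    push_cast
    simp only [one_pow]
    linear_combination (w ^ (n - 1) * w ^ l * d⁄dX ℚ w) * hC
  -- Since `X ∣ 1 - w`, the derivative is divisible by `X^N`; integrating gains one more power.
  have hdvd : X ^ (N + 1) ∣ (∑ l ∈ Finset.range (N + 1), C (a l) * w ^ (n + l)) - 1 := by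
    apply X_pow_dvd_of_derivative
    · simp only [map_sub, map_sum, map_mul, map_pow, hw1, one_pow, mul_one, map_one,
        constantCoeff_C]
      rw [sum_neg_one_pow_mul_choose_div hn, sub_self]
    · rw [map_sub, derivative_one, sub_zero, hder]
      have : X ∣ 1 - w := by rw [X_dvd_iff]; simp [hw1]
      exact ((((pow_dvd_pow_of_dvd this N).mul_left _).mul_right _).mul_left _)
  have hsum : (∑ l ∈ Finset.range (N + 1), C (a l) * w ^ l) - w⁻¹ ^ n =
      ((∑ l ∈ Finset.range (N + 1), C (a l) * w ^ (n + l)) - 1) * w⁻¹ ^ n := by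
    rw [sub_mul, one_mul, Finset.sum_mul]
    congr 1
    refine Finset.sum_congr rfl fun l _ => ?_
    have : w ^ n * w⁻¹ ^ n = 1 := by rw [← mul_pow, hwv, one_pow]
    rw [pow_add]
    linear_combination -(C (a l) * w ^ l) * this
  have hz := (X_pow_dvd_iff.mp (hsum ▸ hdvd.mul_right (w⁻¹ ^ n))) N (by omega)
  rw [map_sub, map_sum, sub_eq_zero] at hz
  rw [← hz]
  exact Finset.sum_congr rfl fun l _ => coeff_C_mul _ _ _

theorem expI_pow (y : ℂ) (r : ℕ) : expI y ^ r = expI (r * y) := by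
  induction r with
  | zero =>
    ext k
    rw [coeff_expI, pow_zero, coeff_one]
    cases k <;> simp
  | succ r ih => rw [pow_succ, ih, expI_mul]; push_cast; ring_nf

theorem expI_one_sub : expI 1 - expI (-1) = C (2 * Complex.I) * PowerSeries.sin ℂ := by
  ext k
  rw [map_sub, coeff_expI, coeff_expI, coeff_C_mul, PowerSeries.sin, coeff_mk]
  obtain ⟨j, rfl | rfl⟩ := k.even_or_odd'
  · simp
  · have : ¬ Even (2 * j + 1) := by simp
    have h2 : (2 * j + 1) / 2 = j := by omega
    simp [this, h2, pow_succ, pow_mul]; ring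

/-- Expand `(2i sin X)^l = (e^{iX} - e^{-iX})^l` binomially and read off degree `2k + l`, the extra
`l` coming from `sin X = X w`. -/
theorem coeff_sincSeries_pow (l k : ℕ) :
    coeff (2 * k) (sincSeries ℚ ^ l) = (-1) ^ k / (2 ^ l * ((2 * k + l).factorial : ℚ)) *
      ∑ r ∈ Finset.range (l + 1), (-1) ^ (l - r) * (l.choose r : ℚ) *
        (2 * (r : ℚ) - l) ^ (2 * k + l) := by
  have h1 : C ((2 * Complex.I) ^ l) * PowerSeries.sin ℂ ^ l = ∑ r ∈ Finset.range (l + 1),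
      C ((-1) ^ (l - r) * (l.choose r : ℂ)) * expI (2 * r - l) := by
    rw [map_pow, ← mul_pow, ← expI_one_sub, sub_eq_add_neg, add_pow]
    refine Finset.sum_congr rfl fun r hr => ?_
    have hr' : r ≤ l := by simp at hr; omega
    rw [neg_pow (expI (-1)), expI_pow, expI_pow, map_mul, map_pow, map_neg, map_one, map_natCast]
    have h2 : expI (2 * r - l) = expI (r * 1) * expI ((l - r : ℕ) * -1) := by
      rw [expI_mul]; congr 1; push_cast [hr']; ring
    rw [h2]; ring
  have h2 := congrArg (coeff (2 * k + l)) h1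
  rw [coeff_C_mul, ← X_mul_sincSeries, mul_pow X, mul_comm (X ^ l), coeff_mul_X_pow, map_sum] at h2
  have h3 : (coeff (2 * k) (sincSeries ℂ ^ l)) =
      ((coeff (2 * k) (sincSeries ℚ ^ l) : ℚ) : ℂ) := by
    rw [← map_sincSeries ℚ (Rat.castHom ℂ), ← map_pow, coeff_map]; simp
  have hf : ((2 * k + l).factorial : ℂ) ≠ 0 := by exact_mod_cast Nat.factorial_ne_zero _
  have hI : Complex.I ^ l ≠ 0 := pow_ne_zero _ Complex.I_ne_zero
  have h4 : ∀ r ∈ Finset.range (l + 1),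
      coeff (2 * k + l) (C ((-1) ^ (l - r) * (l.choose r : ℂ)) * expI (2 * r - l)) =
      (Complex.I ^ l * (-1) ^ k / ((2 * k + l).factorial : ℂ)) *
        ((-1) ^ (l - r) * (l.choose r : ℂ) * (2 * (r : ℂ) - l) ^ (2 * k + l)) := by
    intro r _
    rw [coeff_C_mul, coeff_expI, pow_add Complex.I, pow_mul, Complex.I_sq]
    ring
  rw [h3, Finset.sum_congr rfl h4, ← Finset.mul_sum] at h2
  have h5 : ((coeff (2 * k) (sincSeries ℚ ^ l) : ℚ) : ℂ) =
      (-1) ^ k / (2 ^ l * ((2 * k + l).factorial : ℂ)) *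
      ∑ r ∈ Finset.range (l + 1), (-1) ^ (l - r) * (l.choose r : ℂ) *
        (2 * (r : ℂ) - l) ^ (2 * k + l) := by
    rw [mul_pow] at h2
    rw [← mul_right_inj' (mul_ne_zero (pow_ne_zero l (two_ne_zero' ℂ)) hI), h2]
    field_simp
  exact_mod_cast h5

theorem cscCoeff_eq_sum {n : ℕ} (hn : 0 < n) (k : ℕ) :
    cscCoeff n k =
      (-1) ^ k * (Nat.choose (n + 2 * k) n : ℚ) *
        ∑ l ∈ Finset.range (2 * k + 1),
          (n : ℚ) / ((n : ℚ) + (l : ℚ)) * (Nat.choose (2 * k) l : ℚ) *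
            (1 / (2 ^ l * (Nat.factorial (2 * k + l) : ℚ))) *
            ∑ r ∈ Finset.range (l + 1),
              (-1) ^ r * (Nat.choose l r : ℚ) *
                (2 * (r : ℚ) - (l : ℚ)) ^ (2 * k + l) := by
  rw [cscCoeff_eq_coeff, coeff_inv_sincSeries_pow hn, Finset.mul_sum]
  refine Finset.sum_congr rfl fun l _ => ?_
  have h : ∑ r ∈ Finset.range (l + 1), (-1 : ℚ) ^ r * (Nat.choose l r : ℚ) *
      (2 * (r : ℚ) - (l : ℚ)) ^ (2 * k + l) = (-1) ^ l * ∑ r ∈ Finset.range (l + 1),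
        (-1) ^ (l - r) * (l.choose r : ℚ) * (2 * (r : ℚ) - l) ^ (2 * k + l) := by
    rw [Finset.mul_sum]
    refine Finset.sum_congr rfl fun r hr => ?_
    have hr' : r ≤ l := by simp at hr; omega
    have h2 : (-1 : ℚ) ^ l * (-1) ^ (l - r) = (-1) ^ r := by
      rw [← pow_add, show l + (l - r) = 2 * (l - r) + r by omega, pow_add, pow_mul]
      simp
    rw [← h2]; ring
  rw [h, coeff_sincSeries_pow]
  ring

end ExplicitCoefficients

/-! ### Convergence of the Laurent series for `0 < |z| < π`. -/

section LaurentExpansion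

open PowerSeries

/-- The Taylor series at `0` of a function `ℂ → ℂ`. -/
noncomputable def taylorSeriesAtZero (f : ℂ → ℂ) : ℂ⟦X⟧ :=
  .mk fun i => iteratedDeriv i f 0 / (i.factorial : ℂ)

theorem taylorSeriesAtZero_congr {f g : ℂ → ℂ} (h : f =ᶠ[nhds 0] g) :
    taylorSeriesAtZero f = taylorSeriesAtZero g := by
  ext i
  rw [taylorSeriesAtZero, taylorSeriesAtZero, coeff_mk, coeff_mk, h.iteratedDeriv_eq]

theorem taylorSeriesAtZero_mul {f g : ℂ → ℂ} (hf : AnalyticAt ℂ f 0) (hg : AnalyticAt ℂ g 0) :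
    taylorSeriesAtZero (f * g) = taylorSeriesAtZero f * taylorSeriesAtZero g := by
  ext i
  rw [coeff_mul, Finset.Nat.sum_antidiagonal_eq_sum_range_succ
    (fun a b => coeff a (taylorSeriesAtZero f) * coeff b (taylorSeriesAtZero g))]
  simp only [taylorSeriesAtZero, coeff_mk]
  rw [iteratedDeriv_mul hf.contDiffAt hg.contDiffAt, Finset.sum_div]
  refine Finset.sum_congr rfl fun a ha => ?_
  have ha' : a ≤ i := by simp at ha; omega
  rw [Nat.cast_choose ℂ ha']
  have h1 : (i.factorial : ℂ) ≠ 0 := by exact_mod_cast i.factorial_ne_zero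
  field_simp

theorem taylorSeriesAtZero_one : taylorSeriesAtZero 1 = 1 := by
  ext i
  rw [taylorSeriesAtZero, coeff_mk, coeff_one, show (1 : ℂ → ℂ) = fun _ => 1 from rfl,
    iteratedDeriv_const]
  split_ifs with h
  · simp [h]
  · simp

theorem taylorSeriesAtZero_pow {f : ℂ → ℂ} (hf : AnalyticAt ℂ f 0) (n : ℕ) :
    taylorSeriesAtZero (f ^ n) = taylorSeriesAtZero f ^ n := by
  induction n with
  | zero => simpa using taylorSeriesAtZero_one
  | succ n ih => rw [pow_succ, taylorSeriesAtZero_mul (hf.pow n) hf, ih, pow_succ]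

theorem taylorSeriesAtZero_id : taylorSeriesAtZero (fun z => z) = X := by
  ext i
  rw [taylorSeriesAtZero, coeff_mk, coeff_X, iteratedDeriv_fun_id_zero]
  split_ifs with h
  · simp [h]
  · simp

theorem taylorSeriesAtZero_sin : taylorSeriesAtZero Complex.sin = PowerSeries.sin ℂ := by
  ext i
  rw [taylorSeriesAtZero, coeff_mk, PowerSeries.sin, coeff_mk]
  obtain ⟨j, rfl | rfl⟩ := i.even_or_odd'
  · simp
  · have : ¬ Even (2 * j + 1) := by simp
    have h2 : (2 * j + 1) / 2 = j := by omega
    simp [this, h2]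

/-- The entire function `sin z / z`. -/
noncomputable def complexSinc : ℂ → ℂ := dslope Complex.sin 0

theorem mul_complexSinc (z : ℂ) : z * complexSinc z = Complex.sin z := by
  simpa [complexSinc] using sub_smul_dslope Complex.sin 0 z

theorem differentiable_complexSinc : Differentiable ℂ complexSinc := by
  rw [← differentiableOn_univ, complexSinc,
    Complex.differentiableOn_dslope Filter.univ_mem]
  exact Complex.differentiable_sin.differentiableOn

theorem complexSinc_ne_zero {z : ℂ} (hz : ‖z‖ < Real.pi) : complexSinc z ≠ 0 := by
  rcases eq_or_ne z 0 with rfl | h0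
  · simp [complexSinc]
  · intro h
    have hs := mul_complexSinc z
    rw [h, mul_zero, eq_comm, Complex.sin_eq_zero_iff] at hs
    obtain ⟨k, rfl⟩ := hs
    have hk : k ≠ 0 := by rintro rfl; simp at h0
    have h1 : (1 : ℝ) ≤ |(k : ℝ)| := by exact_mod_cast Int.one_le_abs hk
    rw [norm_mul, Complex.norm_intCast, Complex.norm_real, Real.norm_of_nonneg Real.pi_pos.le] at hz
    nlinarith [Real.pi_pos]

theorem taylorSeriesAtZero_complexSinc :
    taylorSeriesAtZero complexSinc = sincSeries ℂ := by
  have h : (fun z => z) * complexSinc = Complex.sin := funext mul_complexSinc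
  have h1 : X * taylorSeriesAtZero complexSinc = X * sincSeries ℂ := by
    rw [X_mul_sincSeries, ← taylorSeriesAtZero_sin, ← h, taylorSeriesAtZero_mul
      (f := fun z => z) analyticAt_id (differentiable_complexSinc.analyticAt 0), taylorSeriesAtZero_id]
  exact mul_left_cancel₀ X_ne_zero h1

theorem taylorSeriesAtZero_complexSinc_inv_pow (n : ℕ) :
    taylorSeriesAtZero (complexSinc⁻¹ ^ n) = (sincSeries ℂ)⁻¹ ^ n := by
  have hs := differentiable_complexSinc.analyticAt 0
  have h0 : complexSinc 0 ≠ 0 := complexSinc_ne_zero (by simpa using Real.pi_pos)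
  rw [taylorSeriesAtZero_pow (hs.inv h0)]
  congr 1
  apply eq_inv_sincSeries
  rw [← taylorSeriesAtZero_complexSinc, ← taylorSeriesAtZero_mul hs (hs.inv h0),
    ← taylorSeriesAtZero_one]
  -- The product with the pointwise inverse is 1 only near 0, since `complexSinc` vanishes at
  -- nonzero multiples of `π`; the germ suffices.
  apply taylorSeriesAtZero_congr
  filter_upwards [hs.continuousAt.eventually_ne h0] with z hz
  simp [hz]

theorem hasSum_csc_pow (n : ℕ) {z : ℂ} (hz0 : 0 < ‖z‖) (hz : ‖z‖ < Real.pi) :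
    HasSum (fun k : ℕ => z ^ (2 * (k : ℤ) - (n : ℤ)) * (cscCoeff n k : ℂ))
      ((1 / Complex.sin z) ^ n) := by
  have hne : z ≠ 0 := norm_pos_iff.mp hz0
  have hd : DifferentiableOn ℂ (complexSinc⁻¹ ^ n) (Metric.ball 0 Real.pi) := by
    apply DifferentiableOn.pow
    exact differentiable_complexSinc.differentiableOn.inv fun w hw =>
      complexSinc_ne_zero (by simpa using hw)
  have h := Complex.hasSum_taylorSeries_on_ball hd (z := z) (by simpa using hz)
  have h1 : (fun i : ℕ => (i.factorial : ℂ)⁻¹ • (z - 0) ^ i •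
      iteratedDeriv i (complexSinc⁻¹ ^ n) 0) =
      fun i => z ^ i * coeff i ((sincSeries ℂ)⁻¹ ^ n) := by
    funext i
    rw [← taylorSeriesAtZero_complexSinc_inv_pow, taylorSeriesAtZero, coeff_mk, sub_zero,
      smul_eq_mul, smul_eq_mul]
    ring
  -- Odd coefficients vanish, so the Taylor sum may be reindexed by `i = 2k`.
  rw [h1, ← Function.Injective.hasSum_iff (mul_right_injective₀ (two_ne_zero' ℕ))] at h
  · have h2 := h.mul_left (z ^ (-(n : ℤ)))
    have hterm : (fun k : ℕ => z ^ (2 * (k : ℤ) - (n : ℤ)) * (cscCoeff n k : ℂ)) = fun k =>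
        z ^ (-(n : ℤ)) * ((fun i => z ^ i * coeff i ((sincSeries ℂ)⁻¹ ^ n)) ∘ (2 * ·)) k := by
      funext k
      rw [cast_cscCoeff, Function.comp_apply, sub_eq_neg_add, zpow_add₀ hne, mul_assoc]
      norm_cast
    have hval : (1 / Complex.sin z) ^ n = z ^ (-(n : ℤ)) * (complexSinc⁻¹ ^ n) z := by
      rw [← mul_complexSinc, Pi.pow_apply, Pi.inv_apply, zpow_neg, zpow_natCast, one_div, mul_inv,
        mul_pow, inv_pow]
    rw [hterm, hval]
    exact h2
  · intro i hi
    rw [coeff_inv_sincSeries_pow_of_odd ℂ n, mul_zero]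
    rw [← Nat.not_even_iff_odd, even_iff_exists_two_mul]
    rintro ⟨j, rfl⟩
    exact hi ⟨j, rfl⟩

end LaurentExpansion

/-! ### The law of the sum of independent uniform variables. -/

section Probability

open MeasureTheory ProbabilityTheory

theorem measureReal_eq_uniformMass {Ω : Type*} [MeasurableSpace Ω] {P : Measure Ω}
    {X : Ω → ℤ} {m : ℕ} (hX : pdf.IsUniform X (Set.Icc (-(m : ℤ)) (m : ℤ)) P Measure.count)
    (k : ℤ) : P.real (X ⁻¹' {k}) = (uniformMass m k : ℝ) := by
  have hcount : Measure.count (Set.Icc (-(m : ℤ)) (m : ℤ)) = ((2 * m + 1 : ℕ) : ENNReal) := by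
    rw [← Finset.coe_Icc, Measure.count_apply_finset, Int.card_Icc]
    congr 1; omega
  rw [measureReal_def, hX.measure_preimage (by rw [hcount]; simp)
    (by rw [hcount]; exact ENNReal.natCast_ne_top _) (measurableSet_singleton k), hcount,
    uniformMass]
  by_cases hk : |k| ≤ (m : ℤ)
  · have : Set.Icc (-(m : ℤ)) (m : ℤ) ∩ {k} = {k} :=
      Set.inter_eq_right.mpr (Set.singleton_subset_iff.mpr (abs_le.mp hk))
    rw [if_pos hk, this, Measure.count_singleton, ENNReal.toReal_div, ENNReal.toReal_natCast]
    simp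
  · have : Set.Icc (-(m : ℤ)) (m : ℤ) ∩ {k} = ∅ :=
      Set.inter_singleton_eq_empty.mpr fun h => hk (abs_le.mpr h)
    rw [if_neg hk, this]
    simp

theorem measureReal_sum_eq_convMass {n : ℕ} (m : Fin n → ℕ) {Ω : Type*} [MeasurableSpace Ω]
    (P : Measure Ω) [IsProbabilityMeasure P] {X : Fin n → Ω → ℤ} (hX : ∀ j, Measurable (X j))
    (hindep : iIndepFun X P)
    (hunif : ∀ j, pdf.IsUniform (X j) (Set.Icc (-(m j : ℤ)) (m j : ℤ)) P Measure.count) (p : ℤ) :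
    P.real {ω | ∑ j, X j ω = p} = (convMass m p : ℝ) := by
  classical
  have hpt : ∀ k : Fin n → ℤ, P.real ((fun ω j => X j ω) ⁻¹' {k}) =
      ((∏ j, uniformMass (m j) (k j) : ℚ) : ℝ) := by
    intro k
    have h1 : (fun ω j => X j ω) ⁻¹' {k} = ⋂ j ∈ Finset.univ, X j ⁻¹' {k j} := by
      ext ω; simp [funext_iff]
    rw [h1, measureReal_def, hindep.measure_inter_preimage_eq_mul Finset.univ
      (fun j _ => measurableSet_singleton (k j)), ENNReal.toReal_prod, Rat.cast_prod]
    exact Finset.prod_congr rfl fun j _ => measureReal_eq_uniformMass (hunif j) (k j)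
  have hXm : Measurable fun ω j => X j ω := measurable_pi_lambda _ hX
  set S : Finset (Fin n → ℤ) := Fintype.piFinset fun j => Finset.Icc (-(m j : ℤ)) (m j) with hS
  -- The complement of the box is a countable union of null fibres, so up to a null set the event is
  -- a finite union of fibres.
  have hnull : P {ω | (fun j => X j ω) ∉ S} = 0 := by
    have : {ω | (fun j => X j ω) ∉ S} = ⋃ k ∈ {k : Fin n → ℤ | k ∉ S},
        (fun ω j => X j ω) ⁻¹' {k} := by
      ext ω; simp
    rw [this, measure_biUnion_null_iff (Set.to_countable _)]
    intro k hk
    have h0 : P.real ((fun ω j => X j ω) ⁻¹' {k}) = 0 := by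
      rw [hpt, Rat.cast_eq_zero, Finset.prod_eq_zero_iff]
      rw [Set.mem_ofPred_eq, hS, Fintype.mem_piFinset] at hk
      push Not at hk
      obtain ⟨j, hj⟩ := hk
      refine ⟨j, Finset.mem_univ j, if_neg fun h => hj (Finset.mem_Icc.mpr (abs_le.mp h))⟩
    rwa [measureReal_eq_zero_iff] at h0
  have hae : {ω | ∑ j, X j ω = p} =ᵐ[P]
      (fun ω j => X j ω) ⁻¹' (S.filter fun k => ∑ j, k j = p : Finset (Fin n → ℤ)) := by
    have : ∀ᵐ ω ∂P, (fun j => X j ω) ∈ S := hnull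
    filter_upwards [this] with ω hω
    apply propext
    change (∑ j, X j ω = p) ↔ (fun j => X j ω) ∈ ((S.filter fun k => ∑ j, k j = p) : Set _)
    simp [hω]
  rw [measureReal_congr hae, ← sum_measureReal_preimage_singleton _
    (fun k _ => hXm (measurableSet_singleton k)), convMass_eq_sum, ← Finset.sum_filter,
    Rat.cast_sum]
  exact Finset.sum_congr rfl fun k _ => hpt k

end Probability

theorem theorem2 (n : ℕ) (hn : 0 < n) (m : Fin n → ℕ) (hm : ∀ j, 0 < m j) :
    -- `convMass m` is the probability mass function of the sum
    (∀ (Ω : Type*) [MeasurableSpace Ω] (P : MeasureTheory.Measure Ω)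
        [MeasureTheory.IsProbabilityMeasure P] (X : Fin n → Ω → ℤ),
        (∀ j, Measurable (X j)) →
        ProbabilityTheory.iIndepFun X P →
        (∀ j, MeasureTheory.pdf.IsUniform (X j) (Set.Icc (-(m j : ℤ)) (m j : ℤ)) P
          MeasureTheory.Measure.count) →
        ∀ p : ℤ, P.real {ω | ∑ j, X j ω = p} = (convMass m p : ℝ)) ∧
    -- the formula for the mass function
    (∀ p : ℤ, convMass m p =
      (∏ j, (2 * (m j : ℚ) + 1)⁻¹) / 2 ^ n *
        ∑ ε ∈ signVectors n,
          ((signedShift m p ε).sign : ℚ) * (∏ j, (ε j : ℚ)) *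
            ∑ k ∈ Finset.range ((n - 1) / 2 + 1),
              (-1) ^ k * cscCoeff n k *
                ((signedShift m p ε : ℚ) ^ (n - 2 * k - 1) /
                  (Nat.factorial (n - 2 * k - 1) : ℚ))) ∧
    -- the Laurent expansion of `(1 / sin z) ^ n` at the origin
    (∀ z : ℂ, 0 < ‖z‖ → ‖z‖ < Real.pi →
      HasSum (fun k : ℕ => z ^ (2 * (k : ℤ) - (n : ℤ)) * (cscCoeff n k : ℂ))
        ((1 / Complex.sin z) ^ n)) ∧
    -- the explicit formula for the Laurent coefficients
    (∀ k : ℕ, cscCoeff n k =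
      (-1) ^ k * (Nat.choose (n + 2 * k) n : ℚ) *
        ∑ l ∈ Finset.range (2 * k + 1),
          (n : ℚ) / ((n : ℚ) + (l : ℚ)) * (Nat.choose (2 * k) l : ℚ) *
            (1 / (2 ^ l * (Nat.factorial (2 * k + l) : ℚ))) *
            ∑ r ∈ Finset.range (l + 1),
              (-1) ^ r * (Nat.choose l r : ℚ) *
                (2 * (r : ℚ) - (l : ℚ)) ^ (2 * k + l)) := by
  exact ⟨fun Ω _ P _ X hX hindep hunif p => measureReal_sum_eq_convMass m P hX hindep hunif p,
    convMass_eq_sum_signVectors hn m, fun z hz0 hz => hasSum_csc_pow n hz0 hz, cscCoeff_eq_sum hn⟩
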